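/- **Definitions.** For $\alpha\in\mathbb R^n$ and $\gamma>0$, with Euclidean norm and distance, let $$\mathrm{LCD}_\gamma(\alpha)=\inf\left\{\theta>0:\ \mathrm{dist}(\theta\alpha,\mathbb Z^n)\le \min\left\{\gamma,\tfrac1{10}\|\theta\alpha\|\right\}\right\}.$$ For a real random variable $Y$ let $Q_Y(t)=\sup_{a\in\mathbb R}\mathbf P\{a\le Y\le a+t\}$ be its Lévy concentration function. A mean-zero random variable $Y$ is sub-exponential with parameters $(\nu,b)$, $\nu,b>0$, if $\mathbf E[e^{\lambda Y}]\le e^{\lambda^2\nu^2/2}$ for all $|\lambda|\le 1/b$. **Theorem.** Let $\nu,b,r>0$ and $p<1$. There is a constant $c'>0$ depending only on $\nu,b,r,p$, and for every $\kappa\in(0,1)$ there is a constant $C'>0$ depending only on $\nu,b,r,p,\kappa$, such that the following holds. Let $n\ge 1$ and let $X_1,\dots,X_n$ be i.i.d. mean-zero random variables that are sub-exponential with parameters $(\nu,b)$ and satisfy $Q_{X_1}(r)\le p$ (every non-degenerate distribution satisfies this for some $r>0$ and $p<1$). Write $X=(X_1,\dots,X_n)$. Then for all $\alpha,\beta\in\mathbb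 R^n$ with $\alpha\ne0$ and $\|\beta\|\le\kappa\|\alpha\|$, and all $\gamma>0$, $$\mathbf P\{|\langle\alpha,X\rangle|\le|\langle\beta,X\rangle|\}\le C'\left\{\frac{\|\beta\|}{\|\alpha\|}\log\frac{\|\alpha\|}{\|\beta\|}+\frac1{\mathrm{LCD}_\gamma(\alpha/\|\alpha\|)}+e^{-c'\gamma^2}\right\},$$ where the first term on the right is read as $0$ when $\beta=0$. -/

import Mathlib

open MeasureTheory ProbabilityTheory

noncomputable section

namespace RelAntiConc

/-- The integer lattice `ℤⁿ` inside Euclidean space `ℝⁿ`. -/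
def intLattice (n : ℕ) : Set (EuclideanSpace ℝ (Fin n)) :=
  {z | ∀ i, ∃ m : ℤ, z i = (m : ℝ)}

/-- The essential least common denominator
`LCD_γ(α) = inf {θ > 0 : dist(θα, ℤⁿ) ≤ min {γ, ‖θα‖ / 10}}`, with Euclidean norm and distance.
For `γ > 0` the set is nonempty by Dirichlet's simultaneous approximation theorem, so this is a
genuine infimum of a nonempty set of reals that is bounded below. -/
def LCD {n : ℕ} (γ : ℝ) (α : EuclideanSpace ℝ (Fin n)) : ℝ :=
  sInf {θ : ℝ | 0 < θ ∧
    Metric.infDist (θ • α) (intLattice n) ≤ min γ ((1 / 10) * ‖θ • α‖)}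

/-- The Lévy concentration function `Q_X(t) = sup_a P{a ≤ X ≤ a + t}`. -/
def levyConcentration {Ω : Type*} [MeasurableSpace Ω] (X : Ω → ℝ) (P : Measure Ω) (t : ℝ) : ℝ :=
  ⨆ a : ℝ, P.real {ω | a ≤ X ω ∧ X ω ≤ a + t}

/-- `X` has mean zero and is sub-exponential with parameters `(ν, b)`:
`E[exp(λX)] ≤ exp(λ²ν²/2)` for all `|λ| ≤ 1/b` (in particular these expectations are finite). -/
structure IsSubExponential {Ω : Type*} [MeasurableSpace Ω] (X : Ω → ℝ) (ν b : ℝ)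
    (P : Measure Ω) : Prop where
  integrable : Integrable X P
  mean_zero : ∫ ω, X ω ∂P = 0
  integrable_exp : ∀ l : ℝ, |l| ≤ 1 / b → Integrable (fun ω => Real.exp (l * X ω)) P
  mgf_le : ∀ l : ℝ, |l| ≤ 1 / b →
    ∫ ω, Real.exp (l * X ω) ∂P ≤ Real.exp (l ^ 2 * ν ^ 2 / 2)

end RelAntiConc

end

namespace RelAntiConc

/-! Put `ρ = ‖β‖/‖α‖` and split at the level `b‖β‖ log(1/ρ)`. A Chernoff bound shows that `|⟨β,X⟩|`
reaches this level with probability `O(ρ)`, and `log(1/ρ) ≥ log(1/κ)` absorbs this into `ρ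
log(1/ρ)`. Otherwise `|⟨α,X⟩|/‖α‖ ≤ bρ log(1/ρ)`, and a small ball estimate for the unit vector
`α/‖α‖` applies (`measureReal_abs_sum_le_of_LCD`).

The small ball estimate uses no moments. Esseen's inequality reduces it to integrating `∏
|φ(αᵢt/ε)|`, with `φ` the common characteristic function. If `Y` is the symmetrized variable, then
`|φ(t)| ≤ exp(-E(1 - cos tY)/2)`, and `|Y| > r/2` has probability at least `1 - p`. Conditioning on
this event and applying Jensen reduces to a fixed value `y` of `Y`, where `∑ (1 - cos)` dominates
the squared distance of a multiple of `α` to `ℤⁿ`. Two multiples `sα`, `tα` with `0 < |s - t| < LCD`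
cannot both be close to the lattice, so the integrand is small except near few points. -/

/-! ### Esseen's inequality. -/

lemma half_le_cos_of_abs_le_one {x : ℝ} (hx : |x| ≤ 1) : 1 / 2 ≤ Real.cos x := by
  have := Real.one_sub_sq_div_two_le_cos (x := x)
  have : x ^ 2 ≤ 1 := (sq_le_one_iff_abs_le_one x).2 hx
  linarith

lemma integral_cos_eq_re_charFun (μ : Measure ℝ) [IsFiniteMeasure μ] (t : ℝ) :
    ∫ x, Real.cos (t * x) ∂μ = (charFun μ t).re := by
  rw [charFun_apply_real]
  have hint : Integrable (fun x : ℝ => Complex.exp (t * x * Complex.I)) μ := by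
    refine Integrable.of_bound (by fun_prop) 1 (Filter.Eventually.of_forall fun x => ?_)
    rw [← Complex.ofReal_mul, Complex.norm_exp_ofReal_mul_I]
  have h := integral_re hint
  simp only [RCLike.re_eq_complex_re] at h
  rw [← h]
  refine integral_congr_ae (Filter.Eventually.of_forall fun x => ?_)
  simp only
  rw [← Complex.ofReal_mul, Complex.exp_ofReal_mul_I_re]

/-- The double integral is `|∫₀¹ exp(iuy) du|²`, a sum of two squares. This makes it usable as a
nonnegative kernel majorizing an indicator. -/
lemma intervalIntegral_cos_sub_nonneg (y : ℝ) :
    0 ≤ ∫ s in (0 : ℝ)..1, ∫ u in (0 : ℝ)..1, Real.cos ((s - u) * y) := by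
  have h : ∀ s : ℝ, ∫ u in (0 : ℝ)..1, Real.cos ((s - u) * y) =
      Real.cos (s * y) * (∫ u in (0 : ℝ)..1, Real.cos (u * y)) +
      Real.sin (s * y) * ∫ u in (0 : ℝ)..1, Real.sin (u * y) := by
    intro s
    rw [← intervalIntegral.integral_const_mul, ← intervalIntegral.integral_const_mul,
      ← intervalIntegral.integral_add]
    · refine intervalIntegral.integral_congr fun u _ => ?_
      simp only [sub_mul, Real.cos_sub]
    all_goals exact Continuous.intervalIntegrable (by fun_prop) _ _
  simp only [h]
  rw [intervalIntegral.integral_add, intervalIntegral.integral_mul_const,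
    intervalIntegral.integral_mul_const]
  · exact add_nonneg (mul_self_nonneg _) (mul_self_nonneg _)
  all_goals exact Continuous.intervalIntegrable (by fun_prop) _ _

lemma half_le_intervalIntegral_cos_sub {y : ℝ} (hy : |y| ≤ 1) :
    1 / 2 ≤ ∫ s in (0 : ℝ)..1, ∫ u in (0 : ℝ)..1, Real.cos ((s - u) * y) := by
  have h1 : ∀ s ∈ Set.Icc (0 : ℝ) 1,
      1 / 2 ≤ ∫ u in (0 : ℝ)..1, Real.cos ((s - u) * y) := by
    intro s hs
    have : ∫ u in (0 : ℝ)..1, (1 / 2 : ℝ) = 1 / 2 := by simp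
    rw [← this]
    refine intervalIntegral.integral_mono_on zero_le_one (by simp)
      (Continuous.intervalIntegrable (by fun_prop) _ _) fun u hu => half_le_cos_of_abs_le_one ?_
    rw [abs_mul]
    refine mul_le_one₀ (abs_le.2 ⟨?_, ?_⟩) (abs_nonneg _) hy <;> linarith [hs.1, hs.2, hu.1, hu.2]
  have : ∫ u in (0 : ℝ)..1, (1 / 2 : ℝ) = 1 / 2 := by simp
  rw [← this]
  refine intervalIntegral.integral_mono_on zero_le_one (by simp)
    (Continuous.intervalIntegrable ?_ _ _) h1
  exact intervalIntegral.continuous_parametric_intervalIntegral_of_continuous' (by fun_prop) _ _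

lemma integral_intervalIntegral_swap_of_continuous (μ : Measure ℝ) [IsFiniteMeasure μ]
    {f : ℝ → ℝ → ℝ} {C : ℝ} (hf : Continuous fun q : ℝ × ℝ => f q.1 q.2)
    (hC : ∀ x u, ‖f x u‖ ≤ C) (a b : ℝ) :
    ∫ x, (∫ u in a..b, f x u) ∂μ = ∫ u in a..b, ∫ x, f x u ∂μ := by
  have : IsFiniteMeasure (volume.restrict (Set.uIoc a b)) := ⟨by simp [Set.uIoc]⟩
  refine (intervalIntegral_integral_swap (f := fun u x => f x u) ?_).symm
  exact Integrable.of_bound (hf.comp continuous_swap).aestronglyMeasurable C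
    (Filter.Eventually.of_forall fun q => hC _ _)

/-- Esseen's inequality for intervals centred at the origin. -/
lemma measureReal_abs_le_le_integral_charFun (τ : Measure ℝ) [IsProbabilityMeasure τ]
    {ε : ℝ} (hε : 0 < ε) :
    τ.real {x | |x| ≤ ε} ≤ 2 * ∫ t in (-1 : ℝ)..1, ‖charFun τ (t / ε)‖ := by
  set K : ℝ → ℝ := fun x => ∫ s in (0 : ℝ)..1, ∫ u in (0 : ℝ)..1, Real.cos ((s - u) * (x / ε))
    with hK
  have hcont : Continuous fun q : ℝ × ℝ => ∫ u in (0 : ℝ)..1, Real.cos ((q.2 - u) * (q.1 / ε)) :=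
    intervalIntegral.continuous_parametric_intervalIntegral_of_continuous' (by fun_prop) _ _
  have hKcont : Continuous K :=
    intervalIntegral.continuous_parametric_intervalIntegral_of_continuous'
      (f := fun x s => ∫ u in (0 : ℝ)..1, Real.cos ((s - u) * (x / ε))) hcont _ _
  have hinner : ∀ x s : ℝ, ‖∫ u in (0 : ℝ)..1, Real.cos ((s - u) * (x / ε))‖ ≤ 1 := by
    intro x s
    simpa using intervalIntegral.norm_integral_le_of_norm_le_const (a := 0) (b := 1) (C := 1)
      (f := fun u => Real.cos ((s - u) * (x / ε))) fun u _ => Real.abs_cos_le_one _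
  have hKbound : ∀ x, ‖K x‖ ≤ 1 := by
    intro x
    simpa using intervalIntegral.norm_integral_le_of_norm_le_const (a := 0) (b := 1) (C := 1)
      (f := fun s => ∫ u in (0 : ℝ)..1, Real.cos ((s - u) * (x / ε))) fun s _ => hinner x s
  have hKint : Integrable K τ :=
    Integrable.of_bound hKcont.aestronglyMeasurable 1 (Filter.Eventually.of_forall hKbound)
  have hms : MeasurableSet {x : ℝ | |x| ≤ ε} := measurableSet_le (by fun_prop) (by fun_prop)
  have hcf : Continuous (charFun τ) := continuous_charFun
  -- The kernel `2K` is at least 1 on `[-ε, ε]` and nonnegative elsewhere.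
  have hle : τ.real {x | |x| ≤ ε} ≤ 2 * ∫ x, K x ∂τ := by
    rw [← integral_indicator_one hms, ← integral_const_mul]
    refine integral_mono ((integrable_const (1 : ℝ)).indicator hms) (hKint.const_mul 2) fun x => ?_
    by_cases hx : |x| ≤ ε
    · have h := half_le_intervalIntegral_cos_sub (y := x / ε)
        (by rw [abs_div, abs_of_pos hε]; exact div_le_one_of_le₀ hx hε.le)
      rw [Set.indicator_of_mem (by exact hx)]
      simp only [Pi.one_apply, hK]
      linarith
    · rw [Set.indicator_of_notMem (by exact hx)]
      exact mul_nonneg zero_le_two (intervalIntegral_cos_sub_nonneg _)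
  have hfub : ∫ x, K x ∂τ =
      ∫ s in (0 : ℝ)..1, ∫ u in (0 : ℝ)..1, (charFun τ ((s - u) / ε)).re := by
    simp only [hK]
    rw [integral_intervalIntegral_swap_of_continuous τ (C := 1) hcont hinner]
    refine intervalIntegral.integral_congr fun s _ => ?_
    have h1 := integral_intervalIntegral_swap_of_continuous τ (C := 1)
      (f := fun x u => Real.cos ((s - u) * (x / ε))) (by fun_prop)
      (fun x u => Real.abs_cos_le_one _) 0 1
    refine h1.trans (intervalIntegral.integral_congr fun u _ => ?_)
    rw [← integral_cos_eq_re_charFun]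
    refine integral_congr_ae (Filter.Eventually.of_forall fun x => ?_)
    exact congrArg Real.cos (by ring)
  refine hle.trans (mul_le_mul_of_nonneg_left ?_ zero_le_two)
  rw [hfub]
  -- For fixed `s`, the variable `t = s - u` sweeps `[s - 1, s] ⊆ [-1, 1]`.
  have hb : ∀ s ∈ Set.Icc (0 : ℝ) 1, ∫ u in (0 : ℝ)..1, (charFun τ ((s - u) / ε)).re ≤
      ∫ t in (-1 : ℝ)..1, ‖charFun τ (t / ε)‖ := by
    intro s hs
    calc ∫ u in (0 : ℝ)..1, (charFun τ ((s - u) / ε)).re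
        ≤ ∫ u in (0 : ℝ)..1, ‖charFun τ ((s - u) / ε)‖ := by
          refine intervalIntegral.integral_mono_on zero_le_one
            (Continuous.intervalIntegrable (by fun_prop) _ _)
            (Continuous.intervalIntegrable (by fun_prop) _ _) fun u _ => ?_
          exact (le_abs_self _).trans (Complex.abs_re_le_norm _)
      _ = ∫ t in (s - 1)..(s - 0), ‖charFun τ (t / ε)‖ :=
          intervalIntegral.integral_comp_sub_left (fun t => ‖charFun τ (t / ε)‖) s
      _ ≤ ∫ t in (-1 : ℝ)..1, ‖charFun τ (t / ε)‖ := by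
          refine intervalIntegral.integral_mono_interval (by linarith [hs.1]) (by linarith)
            (by linarith [hs.2]) (Filter.Eventually.of_forall fun _ => norm_nonneg _)
            (Continuous.intervalIntegrable (by fun_prop) _ _)
  calc _ ≤ ∫ s in (0 : ℝ)..1, ∫ t in (-1 : ℝ)..1, ‖charFun τ (t / ε)‖ := by
        refine intervalIntegral.integral_mono_on zero_le_one (Continuous.intervalIntegrable ?_ _ _)
          (by simp) hb
        exact intervalIntegral.continuous_parametric_intervalIntegral_of_continuous'
          (by fun_prop) _ _
    _ = _ := by simp

/-! ### Gaussian-type integrals of functions that are rarely small. -/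

/-- Compare with a minimizer `s₀` of `f` on the interval: `f s + f s₀ ≤ 2 f s`, so `2 f s` is at
least `γ` or `|s - s₀|/10`. The second case contributes at most a full Gaussian integral. -/
lemma intervalIntegral_exp_neg_sq_le_of_sub_lt {f : ℝ → ℝ} (hf : Continuous f)
    (hf0 : ∀ s, 0 ≤ f s) {γ D q : ℝ} (hγ : 0 < γ) (hq : 0 < q)
    (hfD : ∀ s t, |s - t| < D → min γ (|s - t| / 10) ≤ f s + f t)
    {a b : ℝ} (hab : a ≤ b) (hD : b - a < D) :
    ∫ s in a..b, Real.exp (-4 * q * f s ^ 2) ≤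
      (b - a) * Real.exp (-q * γ ^ 2) + √(Real.pi / (q / 100)) := by
  obtain ⟨s₀, hs₀, hmin⟩ := isCompact_Icc.exists_isMinOn (Set.nonempty_Icc.2 hab) hf.continuousOn
  have hpt : ∀ s ∈ Set.Icc a b, Real.exp (-4 * q * f s ^ 2) ≤
      Real.exp (-q * γ ^ 2) + Real.exp (-(q / 100) * (s - s₀) ^ 2) := by
    intro s hs
    have h1 := hfD s s₀ ((abs_sub_le_iff.2 ⟨by linarith [hs.2, hs₀.1], by
      linarith [hs.1, hs₀.2]⟩).trans_lt hD)
    have h2 : f s₀ ≤ f s := hmin hs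
    have h3 := hf0 s
    rcases min_le_iff.1 h1 with h | h
    · refine le_add_of_le_of_nonneg (Real.exp_le_exp.2 ?_) (Real.exp_pos _).le
      have : γ ^ 2 ≤ (2 * f s) ^ 2 := pow_le_pow_left₀ hγ.le (by linarith) 2
      nlinarith
    · refine le_add_of_nonneg_of_le (Real.exp_pos _).le (Real.exp_le_exp.2 ?_)
      have : (|s - s₀| / 10) ^ 2 ≤ (2 * f s) ^ 2 :=
        pow_le_pow_left₀ (by positivity) (by linarith) 2
      rw [div_pow, sq_abs] at this
      nlinarith
  have hg : Integrable fun s : ℝ => Real.exp (-(q / 100) * (s - s₀) ^ 2) :=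
    (integrable_exp_neg_mul_sq (by positivity : 0 < q / 100)).comp_sub_right s₀
  calc ∫ s in a..b, Real.exp (-4 * q * f s ^ 2)
      ≤ ∫ s in a..b, (Real.exp (-q * γ ^ 2) + Real.exp (-(q / 100) * (s - s₀) ^ 2)) :=
        intervalIntegral.integral_mono_on hab (Continuous.intervalIntegrable (by fun_prop) _ _)
          (Continuous.intervalIntegrable (by fun_prop) _ _) hpt
    _ = (b - a) * Real.exp (-q * γ ^ 2) +
          ∫ s in a..b, Real.exp (-(q / 100) * (s - s₀) ^ 2) := by
        rw [intervalIntegral.integral_add (by simp)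
          (Continuous.intervalIntegrable (by fun_prop) _ _)]
        simp
    _ ≤ _ := by
        rw [intervalIntegral.integral_of_le hab, ← integral_gaussian,
          ← integral_sub_right_eq_self (fun x : ℝ => Real.exp (-(q / 100) * x ^ 2)) s₀]
        gcongr
        · exact Filter.Eventually.of_forall fun _ => (Real.exp_pos _).le
        · exact Measure.restrict_le_self

lemma intervalIntegral_exp_neg_sq_le {f : ℝ → ℝ} (hf : Continuous f)
    (hf0 : ∀ s, 0 ≤ f s) {γ D q : ℝ} (hγ : 0 < γ) (hD : 0 < D) (hq : 0 < q)
    (hfD : ∀ s t, |s - t| < D → min γ (|s - t| / 10) ≤ f s + f t)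
    {M : ℝ} (hM : 0 < M) :
    ∫ s in (-M)..M, Real.exp (-4 * q * f s ^ 2) ≤
      2 * M * Real.exp (-q * γ ^ 2) + (4 * M / D + 1) * √(Real.pi / (q / 100)) := by
  -- The factor 4 makes each piece, of length `2M/N`, at most `D/2`, hence strictly shorter than
  -- `D`.
  set N := ⌈4 * M / D⌉₊ with hN
  have hN0 : 0 < 4 * M / D := by positivity
  have hN1 : 4 * M / D ≤ N := Nat.le_ceil _
  have hNpos : (0 : ℝ) < N := hN0.trans_le hN1
  have hN2 : (N : ℝ) ≤ 4 * M / D + 1 := (Nat.ceil_lt_add_one hN0.le).le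
  set a : ℕ → ℝ := fun k => -M + k * (2 * M / N) with ha
  have hstep : ∀ k, a (k + 1) - a k = 2 * M / N := fun k => by simp only [ha]; push_cast; ring
  have hlt : 2 * M / N < D := by
    rw [div_lt_iff₀ hNpos]
    rw [div_le_iff₀ hD] at hN1
    linarith
  have ha0 : a 0 = -M := by simp [ha]
  have haN : a N = M := by simp only [ha]; field_simp; ring
  have hpos : 0 < 2 * M / N := by positivity
  rw [← ha0]
  conv_lhs => rw [← haN]
  rw [← intervalIntegral.sum_integral_adjacent_intervals
    (fun k _ => Continuous.intervalIntegrable (by fun_prop) _ _)]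
  calc _ ≤ ∑ k ∈ Finset.range N,
        (2 * M / N * Real.exp (-q * γ ^ 2) + √(Real.pi / (q / 100))) := by
        refine Finset.sum_le_sum fun k _ => ?_
        have := intervalIntegral_exp_neg_sq_le_of_sub_lt hf hf0 hγ hq hfD
          (a := a k) (b := a (k + 1)) (by linarith [hstep k]) (by rw [hstep]; exact hlt)
        rwa [hstep] at this
    _ = 2 * M * Real.exp (-q * γ ^ 2) + N * √(Real.pi / (q / 100)) := by
        simp only [Finset.sum_const, Finset.card_range, nsmul_eq_mul]
        field_simp
    _ ≤ _ := by gcongr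

lemma intervalIntegral_exp_neg_sq_comp_mul_le {f : ℝ → ℝ} (hf : Continuous f)
    (hf0 : ∀ s, 0 ≤ f s) {γ D q : ℝ} (hγ : 0 < γ) (hD : 0 < D) (hq : 0 < q)
    (hfD : ∀ s t, |s - t| < D → min γ (|s - t| / 10) ≤ f s + f t)
    {M : ℝ} (hM : 0 < M) :
    ∫ t in (-1 : ℝ)..1, Real.exp (-4 * q * f (t * M) ^ 2) ≤
      2 * Real.exp (-q * γ ^ 2) + (4 / D + 1 / M) * √(Real.pi / (q / 100)) := by
  rw [intervalIntegral.integral_comp_mul_right (fun s => Real.exp (-4 * q * f s ^ 2)) hM.ne',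
    smul_eq_mul, neg_one_mul, one_mul]
  calc _ ≤ M⁻¹ * (2 * M * Real.exp (-q * γ ^ 2) +
        (4 * M / D + 1) * √(Real.pi / (q / 100))) := by
        gcongr
        exact intervalIntegral_exp_neg_sq_le hf hf0 hγ hD hq hfD hM
    _ = _ := by field_simp

/-! ### Distance to the integer lattice -/

lemma intLattice_nonempty (n : ℕ) : (intLattice n).Nonempty := ⟨0, fun _ => ⟨0, by simp⟩⟩

lemma infDist_intLattice_sub_le {n : ℕ} (x y : EuclideanSpace ℝ (Fin n)) :
    Metric.infDist (x - y) (intLattice n) ≤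
      Metric.infDist x (intLattice n) + Metric.infDist y (intLattice n) := by
  refine le_of_forall_pos_lt_add fun ε hε => ?_
  obtain ⟨z, hz, hxz⟩ := (Metric.infDist_lt_iff (intLattice_nonempty n)).1
    (lt_add_of_pos_right (Metric.infDist x (intLattice n)) (half_pos hε))
  obtain ⟨w, hw, hyw⟩ := (Metric.infDist_lt_iff (intLattice_nonempty n)).1
    (lt_add_of_pos_right (Metric.infDist y (intLattice n)) (half_pos hε))
  have hmem : z - w ∈ intLattice n := fun i => by
    obtain ⟨k, hk⟩ := hz i
    obtain ⟨l, hl⟩ := hw i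
    exact ⟨k - l, by simp [hk, hl]⟩
  have := Metric.infDist_le_dist_of_mem (x := x - y) hmem
  have := dist_sub_sub_le x y z w
  linarith

lemma infDist_intLattice_neg {n : ℕ} (x : EuclideanSpace ℝ (Fin n)) :
    Metric.infDist (-x) (intLattice n) = Metric.infDist x (intLattice n) := by
  have h0 : Metric.infDist (0 : EuclideanSpace ℝ (Fin n)) (intLattice n) = 0 :=
    Metric.infDist_zero_of_mem fun _ => ⟨0, by simp⟩
  have h : ∀ y : EuclideanSpace ℝ (Fin n),
      Metric.infDist (-y) (intLattice n) ≤ Metric.infDist y (intLattice n) := fun y => by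
    simpa [h0] using infDist_intLattice_sub_le 0 y
  exact le_antisymm (h x) (by simpa using h (-x))

/-- Round each coordinate to the nearest integer and use `1 - cos(2πu) ≥ 8u²` for `|u| ≤ 1/2`. -/
lemma infDist_intLattice_sq_le {n : ℕ} (x : EuclideanSpace ℝ (Fin n)) :
    8 * Metric.infDist x (intLattice n) ^ 2 ≤ ∑ i, (1 - Real.cos (2 * Real.pi * x i)) := by
  set z : EuclideanSpace ℝ (Fin n) := WithLp.toLp 2 fun i => (round (x i) : ℝ)
  have hz : z ∈ intLattice n := fun i => ⟨round (x i), rfl⟩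
  have h1 : Metric.infDist x (intLattice n) ^ 2 ≤ dist x z ^ 2 :=
    pow_le_pow_left₀ Metric.infDist_nonneg (Metric.infDist_le_dist_of_mem hz) 2
  rw [EuclideanSpace.dist_sq_eq] at h1
  calc _ ≤ 8 * ∑ i, dist (x i) (z i) ^ 2 := by gcongr
    _ = ∑ i, 8 * (x i - round (x i)) ^ 2 := by
        rw [Finset.mul_sum]
        refine Finset.sum_congr rfl fun i _ => ?_
        rw [Real.dist_eq, sq_abs]
    _ ≤ _ := by
        refine Finset.sum_le_sum fun i _ => ?_
        have hr := abs_sub_round (x i)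
        have hpi := Real.pi_pos
        have hcos : Real.cos (2 * Real.pi * x i) =
            Real.cos (2 * Real.pi * (x i - round (x i))) := by
          rw [← Real.cos_sub_int_mul_two_pi _ (round (x i))]
          congr 1
          ring
        have := Real.cos_le_one_sub_mul_cos_sq (x := 2 * Real.pi * (x i - round (x i))) (by
          rw [abs_mul, abs_of_pos (by positivity)]
          nlinarith)
        rw [hcos]
        have h8 : 2 / Real.pi ^ 2 * (2 * Real.pi * (x i - round (x i))) ^ 2 =
            8 * (x i - round (x i)) ^ 2 := by
          field_simp
          ring
        linarith

/-! ### Symmetrization and bounds for characteristic functions. -/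

/-- The law of the difference of two independent variables with law `μ`. -/
noncomputable def symmetrization (μ : Measure ℝ) : Measure ℝ := μ.conv (μ.map (fun x => -1 * x))

instance (μ : Measure ℝ) [IsProbabilityMeasure μ] : IsProbabilityMeasure (symmetrization μ) := by
  have : IsProbabilityMeasure (μ.map (fun x => -1 * x)) :=
    Measure.isProbabilityMeasure_map (by fun_prop)
  unfold symmetrization
  infer_instance

lemma charFun_symmetrization (μ : Measure ℝ) [IsProbabilityMeasure μ] (t : ℝ) :
    charFun (symmetrization μ) t = ((‖charFun μ t‖ ^ 2 : ℝ) : ℂ) := by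
  have : IsProbabilityMeasure (μ.map (fun x => -1 * x)) :=
    Measure.isProbabilityMeasure_map (by fun_prop)
  rw [symmetrization, charFun_conv, charFun_map_mul, neg_one_mul, charFun_neg, Complex.mul_conj,
    Complex.normSq_eq_norm_sq]

lemma integral_one_sub_cos_symmetrization (μ : Measure ℝ) [IsProbabilityMeasure μ] (t : ℝ) :
    ∫ y, (1 - Real.cos (t * y)) ∂(symmetrization μ) = 1 - ‖charFun μ t‖ ^ 2 := by
  rw [integral_sub (integrable_const _), integral_cos_eq_re_charFun, charFun_symmetrization,
    Complex.ofReal_re]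
  · simp
  · exact Integrable.of_bound (by fun_prop) 1 (Filter.Eventually.of_forall fun _ =>
      Real.abs_cos_le_one _)

lemma norm_charFun_le_exp_symmetrization (μ : Measure ℝ) [IsProbabilityMeasure μ] (t : ℝ) :
    ‖charFun μ t‖ ≤
      Real.exp (-(1 / 2) * ∫ y, (1 - Real.cos (t * y)) ∂(symmetrization μ)) := by
  rw [integral_one_sub_cos_symmetrization]
  -- With `x = ‖charFun μ t‖`: `x ≤ (1 + x²)/2 ≤ exp((x² - 1)/2)`.
  have h := Real.add_one_le_exp (-(1 / 2) * (1 - ‖charFun μ t‖ ^ 2))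
  nlinarith [sq_nonneg (‖charFun μ t‖ - 1)]

/-- By Fubini: for each fixed `y`, the condition `|x + y| ≤ r/2` confines `x` to an interval of
length `r`. -/
lemma conv_real_abs_le (μ ν : Measure ℝ) [IsProbabilityMeasure μ] [IsProbabilityMeasure ν]
    {r p : ℝ} (h : ∀ a, μ.real {x | a ≤ x ∧ x ≤ a + r} ≤ p) :
    (μ.conv ν).real {y | |y| ≤ r / 2} ≤ p := by
  have hp : 0 ≤ p := measureReal_nonneg.trans (h 0)
  have hS : MeasurableSet {y : ℝ | |y| ≤ r / 2} := measurableSet_le (by fun_prop) (by fun_prop)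
  refine ENNReal.toReal_le_of_le_ofReal hp ?_
  rw [Measure.conv, Measure.map_apply (by fun_prop) hS,
    Measure.prod_apply_symm ((by fun_prop : Measurable fun x : ℝ × ℝ => x.1 + x.2) hS)]
  calc _ ≤ ∫⁻ _, ENNReal.ofReal p ∂ν := by
        refine lintegral_mono fun y => ?_
        rw [ENNReal.le_ofReal_iff_toReal_le (measure_ne_top _ _) hp]
        refine le_trans (measureReal_mono fun x hx => ?_) (h (-y - r / 2))
        have hx' : |x + y| ≤ r / 2 := hx
        rw [abs_le] at hx'
        exact ⟨by linarith [hx'.1], by linarith [hx'.2]⟩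
    _ = ENNReal.ofReal p := by simp

/-- Since `h ≥ 0`, discarding the complement of `S` leaves at least `q` times the conditional mean;
Jensen then moves the exponential inside. -/
lemma exp_neg_integral_le_integral_cond (σ : Measure ℝ) [IsProbabilityMeasure σ] {S : Set ℝ}
    {q B : ℝ} (hq : 0 < q) (hqS : q ≤ σ.real S) {h : ℝ → ℝ}
    (hc : Continuous h) (h0 : ∀ y, 0 ≤ h y) (hB : ∀ y, h y ≤ B) :
    Real.exp (-(1 / 2) * ∫ y, h y ∂σ) ≤ ∫ y, Real.exp (-(q / 2) * h y) ∂σ[|S] := by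
  have hσS : σ S ≠ 0 := fun h => by simp [Measure.real, h] at hqS; linarith
  have : IsProbabilityMeasure (σ[|S]) := cond_isProbabilityMeasure hσS
  have hint : ∀ ρ : Measure ℝ, IsProbabilityMeasure ρ → Integrable h ρ := fun ρ _ =>
    Integrable.of_bound hc.aestronglyMeasurable B
      (Filter.Eventually.of_forall fun y => by rw [Real.norm_of_nonneg (h0 y)]; exact hB y)
  have hcond : σ.real S * ∫ y, h y ∂σ[|S] = ∫ y in S, h y ∂σ := by
    rw [ProbabilityTheory.cond, integral_smul_measure, smul_eq_mul, ENNReal.toReal_inv,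
      ← mul_assoc]
    rw [show (σ S).toReal = σ.real S from rfl, mul_inv_cancel₀ (hq.trans_le hqS).ne', one_mul]
  have h1 : q * ∫ y, h y ∂σ[|S] ≤ ∫ y, h y ∂σ := by
    calc _ ≤ σ.real S * ∫ y, h y ∂σ[|S] :=
          mul_le_mul_of_nonneg_right hqS (integral_nonneg h0)
      _ = ∫ y in S, h y ∂σ := hcond
      _ ≤ _ := setIntegral_le_integral (hint σ inferInstance) (Filter.Eventually.of_forall h0)
  calc Real.exp (-(1 / 2) * ∫ y, h y ∂σ)
      ≤ Real.exp (∫ y, -(q / 2) * h y ∂σ[|S]) := by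
        rw [integral_const_mul]
        exact Real.exp_le_exp.2 (by linarith)
    _ ≤ _ := by
        refine convexOn_exp.map_integral_le (f := fun y => -(q / 2) * h y)
          Real.continuous_exp.continuousOn
          isClosed_univ (by simp) ((hint _ this).const_mul _) ?_
        refine Integrable.of_bound (by fun_prop) 1 (Filter.Eventually.of_forall fun y => ?_)
        simp only [Function.comp, Real.norm_eq_abs, Real.abs_exp]
        refine Real.exp_le_one_iff.2 ?_
        have := mul_nonneg (half_pos hq).le (h0 y)
        linarith

/-! ### The small ball estimate. -/

/-- The cosine sum at `t` dominates 8 times the squared distance of `tM • α` to the lattice, with `M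
= |y|/(2πε)`. The lower bound on `|y|` is what keeps `1/M` of order `ε/r`. -/
lemma intervalIntegral_exp_cos_le {n : ℕ} (α : EuclideanSpace ℝ (Fin n)) {γ D q r ε y : ℝ}
    (hγ : 0 < γ) (hD : 0 < D) (hq : 0 < q) (hr : 0 < r) (hε : 0 < ε)
    (hα : ∀ θ, 0 < θ → θ < D → min γ (θ / 10) ≤ Metric.infDist (θ • α) (intLattice n))
    (hy : r / 2 < |y|) :
    ∫ t in (-1 : ℝ)..1, Real.exp (-(q / 2) * ∑ i, (1 - Real.cos (α i * (t / ε) * y))) ≤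
      2 * Real.exp (-q * γ ^ 2) +
        (4 / D + 4 * Real.pi * ε / r) * √(Real.pi / (q / 100)) := by
  have hpi := Real.pi_pos
  set F : ℝ → ℝ := fun s => Metric.infDist (s • α) (intLattice n) with hF
  have hFc : Continuous F := (Metric.continuous_infDist_pt _).comp (by fun_prop)
  have hFneg : ∀ s, F (-s) = F s := fun s => by
    simp only [hF, neg_smul, infDist_intLattice_neg]
  have hFD : ∀ s t, |s - t| < D → min γ (|s - t| / 10) ≤ F s + F t := by
    intro s t hst
    have h1 : F (s - t) ≤ F s + F t := by
      simp only [hF, sub_smul]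
      exact infDist_intLattice_sub_le _ _
    refine le_trans ?_ h1
    rcases eq_or_ne (s - t) 0 with h | h
    · rw [h, abs_zero, zero_div]
      exact (min_le_right _ _).trans Metric.infDist_nonneg
    · refine (hα _ (abs_pos.2 h) hst).trans_eq ?_
      change F |s - t| = F (s - t)
      rcases abs_choice (s - t) with h' | h' <;> rw [h']
      exact hFneg _
  have hy0 : 0 < |y| := (half_pos hr).trans hy
  set M := |y| / (2 * Real.pi * ε) with hM
  have hMpos : 0 < M := by positivity
  have hpt : ∀ t : ℝ, 8 * F (t * M) ^ 2 ≤ ∑ i, (1 - Real.cos (α i * (t / ε) * y)) := by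
    intro t
    refine (infDist_intLattice_sq_le ((t * M) • α)).trans_eq (Finset.sum_congr rfl fun i _ => ?_)
    have h : 2 * Real.pi * ((t * M) • α) i = α i * (t / ε) * |y| := by
      simp only [PiLp.smul_apply, smul_eq_mul, hM]
      field_simp
    rw [h]
    rcases abs_choice y with h' | h' <;> rw [h']
    rw [mul_neg, Real.cos_neg]
  calc _ ≤ ∫ t in (-1 : ℝ)..1, Real.exp (-4 * q * F (t * M) ^ 2) := by
        refine intervalIntegral.integral_mono_on (by norm_num)
          (Continuous.intervalIntegrable (by fun_prop) _ _)
          (Continuous.intervalIntegrable (by fun_prop) _ _) fun t _ => Real.exp_le_exp.2 ?_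
        have := mul_le_mul_of_nonneg_left (hpt t) (half_pos hq).le
        linarith
    _ ≤ 2 * Real.exp (-q * γ ^ 2) + (4 / D + 1 / M) * √(Real.pi / (q / 100)) :=
        intervalIntegral_exp_neg_sq_comp_mul_le hFc (fun _ => Metric.infDist_nonneg) hγ hD hq hFD
          hMpos
    _ ≤ _ := by
        have : 1 / M ≤ 4 * Real.pi * ε / r := by
          rw [hM, one_div_div, div_le_div_iff₀ hy0 hr]
          have : 0 < Real.pi * ε := by positivity
          nlinarith
        gcongr

/-- Small ball estimate of Rudelson–Vershynin type. -/
lemma measureReal_abs_sum_le_of_infDist {Ω : Type*} [MeasurableSpace Ω] {P : Measure Ω}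
    [IsProbabilityMeasure P] {n : ℕ} {X : Fin n → Ω → ℝ} (hX : ∀ i, Measurable (X i))
    (hind : iIndepFun X P) (μ : Measure ℝ) [IsProbabilityMeasure μ] (hμ : ∀ i, P.map (X i) = μ)
    {r p : ℝ} (hr : 0 < r) (hp : p < 1) (hlevy : ∀ a, μ.real {x | a ≤ x ∧ x ≤ a + r} ≤ p)
    (α : EuclideanSpace ℝ (Fin n)) {γ D ε : ℝ} (hγ : 0 < γ) (hD : 0 < D) (hε : 0 < ε)
    (hα : ∀ θ, 0 < θ → θ < D → min γ (θ / 10) ≤ Metric.infDist (θ • α) (intLattice n)) :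
    P.real {ω | |∑ i, α i * X i ω| ≤ ε} ≤
      2 * (2 * Real.exp (-(1 - p) * γ ^ 2) +
        (4 / D + 4 * Real.pi * ε / r) * √(Real.pi / ((1 - p) / 100))) := by
  set q := 1 - p with hq'
  have hq : 0 < q := by linarith
  set σ := symmetrization μ with hσ
  set S : Set ℝ := {y | r / 2 < |y|} with hSdef
  have hS : MeasurableSet S := measurableSet_lt (by fun_prop) (by fun_prop)
  have hqS : q ≤ σ.real S := by
    have : IsProbabilityMeasure (μ.map (fun x => -1 * x)) :=
      Measure.isProbabilityMeasure_map (by fun_prop)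
    have h1 := conv_real_abs_le μ (μ.map (fun x => -1 * x)) hlevy
    have h2 : Sᶜ = {y | |y| ≤ r / 2} := by ext; simp [hSdef]
    have h3 := probReal_compl_eq_one_sub (μ := σ) hS
    rw [h2] at h3
    change σ.real _ ≤ p at h1
    linarith
  have hσS : σ S ≠ 0 := fun h => by simp [Measure.real, h] at hqS; linarith
  have : IsProbabilityMeasure (σ[|S]) := cond_isProbabilityMeasure hσS
  have hmY : ∀ i, Measurable fun ω => α i * X i ω := fun i => (hX i).const_mul _
  have hmA : Measurable fun ω => ∑ i, α i * X i ω := Finset.measurable_sum _ fun i _ => hmY i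
  set τ := P.map fun ω => ∑ i, α i * X i ω with hτ
  have : IsProbabilityMeasure τ := Measure.isProbabilityMeasure_map hmA.aemeasurable
  have hcf : ∀ s, ‖charFun τ s‖ ≤
      ∫ y, Real.exp (-(q / 2) * ∑ i, (1 - Real.cos (α i * s * y))) ∂σ[|S] := by
    intro s
    have hindY : iIndepFun (fun i ω => α i * X i ω) P :=
      hind.comp (fun i x => α i * x) fun i => measurable_const_mul _
    have hprod := congrFun (hindY.charFun_map_fun_sum_eq_prod fun i => (hmY i).aemeasurable) s
    rw [hτ, hprod, Finset.prod_apply, norm_prod]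
    have hi : ∀ i, charFun (P.map fun ω => α i * X i ω) s = charFun μ (α i * s) := fun i => by
      rw [← hμ i, ← charFun_map_mul, Measure.map_map (by fun_prop) (hX i)]
      rfl
    have hcos : ∀ i, Integrable (fun y => 1 - Real.cos (α i * s * y)) σ := fun i =>
      (integrable_const _).sub (Integrable.of_bound (by fun_prop) 1
        (Filter.Eventually.of_forall fun _ => Real.abs_cos_le_one _))
    calc _ ≤ ∏ i, Real.exp (-(1 / 2) * ∫ y, (1 - Real.cos (α i * s * y)) ∂σ) := by
          refine Finset.prod_le_prod (fun _ _ => norm_nonneg _) fun i _ => ?_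
          rw [hi]
          exact norm_charFun_le_exp_symmetrization μ _
      _ = Real.exp (-(1 / 2) * ∫ y, ∑ i, (1 - Real.cos (α i * s * y)) ∂σ) := by
          rw [← Real.exp_sum, integral_finsetSum _ fun i _ => hcos i, Finset.mul_sum]
      _ ≤ _ := by
          refine exp_neg_integral_le_integral_cond σ hq hqS (B := ∑ _i : Fin n, 2)
            (by fun_prop) (fun y => ?_) fun y => ?_
          · exact Finset.sum_nonneg fun i _ => sub_nonneg.2 (Real.cos_le_one _)
          · exact Finset.sum_le_sum fun i _ => by linarith [Real.neg_one_le_cos (α i * s * y)]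
  have hbd : ∀ t y : ℝ,
      ‖Real.exp (-(q / 2) * ∑ i, (1 - Real.cos (α i * (t / ε) * y)))‖ ≤ 1 := by
    intro t y
    rw [Real.norm_eq_abs, Real.abs_exp, Real.exp_le_one_iff]
    have : 0 ≤ ∑ i, (1 - Real.cos (α i * (t / ε) * y)) :=
      Finset.sum_nonneg fun i _ => sub_nonneg.2 (Real.cos_le_one _)
    have := mul_nonneg (half_pos hq).le this
    linarith
  have hswap := integral_intervalIntegral_swap_of_continuous (σ[|S]) (C := 1)
    (f := fun y t => Real.exp (-(q / 2) * ∑ i, (1 - Real.cos (α i * (t / ε) * y))))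
    (by fun_prop) (fun y t => hbd t y) (-1) 1
  have hmeas : P.real {ω | |∑ i, α i * X i ω| ≤ ε} = τ.real {x | |x| ≤ ε} := by
    rw [hτ, map_measureReal_apply hmA (measurableSet_le (by fun_prop) (by fun_prop))]
    rfl
  rw [hmeas]
  refine (measureReal_abs_le_le_integral_charFun τ hε).trans
    (mul_le_mul_of_nonneg_left ?_ zero_le_two)
  have hcfc : Continuous (charFun τ) := continuous_charFun
  calc _ ≤ ∫ t in (-1 : ℝ)..1,
        ∫ y, Real.exp (-(q / 2) * ∑ i, (1 - Real.cos (α i * (t / ε) * y))) ∂σ[|S] := by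
        refine intervalIntegral.integral_mono_on (by norm_num)
          (Continuous.intervalIntegrable (by fun_prop) _ _)
          (Continuous.intervalIntegrable ?_ _ _) fun t _ => hcf _
        refine continuous_of_dominated (bound := fun _ => 1) (fun t => ?_) (fun t => ?_)
          (integrable_const _) (Filter.Eventually.of_forall fun y => ?_)
        · exact Continuous.aestronglyMeasurable (by fun_prop)
        · exact Filter.Eventually.of_forall fun y => hbd t y
        · fun_prop
    _ ≤ ∫ _, (2 * Real.exp (-q * γ ^ 2) +
        (4 / D + 4 * Real.pi * ε / r) * √(Real.pi / (q / 100))) ∂σ[|S] := by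
        -- After the swap, the `t`-integral has the same bound for every `y` in `S`, and the
        -- conditional law lives on `S`.
        rw [← hswap]
        refine integral_mono_of_nonneg ?_ (integrable_const _) ?_
        · refine Filter.Eventually.of_forall fun y => ?_
          exact intervalIntegral.integral_nonneg (by norm_num) fun _ _ => (Real.exp_pos _).le
        · filter_upwards [ae_cond_mem (μ := σ) hS] with y hy
          exact intervalIntegral_exp_cos_le α hγ hD hq hr hε hα hy
    _ = _ := by simp

/-! ### From lattice distances to `LCD`. -/

lemma le_of_forall_pos_le_add_mul {x a c : ℝ} (h : ∀ δ, 0 < δ → x ≤ a + c * δ) : x ≤ a := by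
  have hc : Continuous fun δ : ℝ => a + c * δ := by fun_prop
  have ht : Filter.Tendsto (fun δ : ℝ => a + c * δ) (nhdsWithin 0 (Set.Ioi 0)) (nhds a) := by
    simpa using (hc.tendsto 0).mono_left nhdsWithin_le_nhds
  exact ge_of_tendsto ht (by filter_upwards [self_mem_nhdsWithin] with δ hδ using h δ hδ)

/-- Below `1/2`, the origin is a nearest lattice point to `θ • α` for a unit vector `α`. -/
lemma le_infDist_intLattice_of_norm_eq_one {n : ℕ} {α : EuclideanSpace ℝ (Fin n)} (hα : ‖α‖ = 1)
    {θ : ℝ} (hθ : 0 < θ) (hθ' : θ ≤ 1 / 2) : θ ≤ Metric.infDist (θ • α) (intLattice n) := by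
  have hnorm : ‖θ • α‖ = θ := by rw [norm_smul, hα, mul_one, Real.norm_of_nonneg hθ.le]
  refine (Metric.le_infDist (intLattice_nonempty n)).2 fun z hz => ?_
  rcases eq_or_ne z 0 with rfl | hz0
  · rw [dist_zero_right, hnorm]
  · obtain ⟨i, hi⟩ : ∃ i, z i ≠ 0 := by
      by_contra! h
      exact hz0 (by ext i; simpa using h i)
    obtain ⟨m, hm⟩ := hz i
    have hm0 : m ≠ 0 := by rintro rfl; simp [hm] at hi
    have h1 : (1 : ℝ) ≤ ‖z i‖ := by
      rw [hm, Real.norm_eq_abs]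
      exact_mod_cast Int.one_le_abs hm0
    have h2 : ‖z i‖ ≤ ‖z‖ := PiLp.norm_apply_le z i
    have h3 := norm_sub_norm_le z (θ • α)
    rw [dist_comm, dist_eq_norm]
    linarith

/-- The alternative `LCD γ α ≤ 0` covers the convention `sInf ∅ = 0`: any element of the defining
set would force `LCD γ α ≥ 1/2`, so in that case the set is empty and every `θ > 0` qualifies. -/
lemma min_le_infDist_of_lt_LCD {n : ℕ} {α : EuclideanSpace ℝ (Fin n)} (hα : ‖α‖ = 1) {γ θ : ℝ}
    (hθ : 0 < θ) (h : θ < LCD γ α ∨ LCD γ α ≤ 0) :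
    min γ (θ / 10) ≤ Metric.infDist (θ • α) (intLattice n) := by
  have hnorm : ∀ θ : ℝ, 0 < θ → ‖θ • α‖ = θ := fun θ hθ => by
    rw [norm_smul, hα, mul_one, Real.norm_of_nonneg hθ.le]
  by_contra! hlt
  have hmem : θ ∈ {θ : ℝ | 0 < θ ∧
      Metric.infDist (θ • α) (intLattice n) ≤ min γ ((1 / 10) * ‖θ • α‖)} := by
    refine ⟨hθ, ?_⟩
    rw [hnorm θ hθ, one_div_mul_eq_div]
    exact hlt.le
  rcases h with h | h
  · exact notMem_of_lt_csInf h ⟨0, fun x hx => hx.1.le⟩ hmem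
  · have : 1 / 2 ≤ LCD γ α := by
      refine le_csInf ⟨θ, hmem⟩ fun x hx => ?_
      by_contra! hx'
      have h1 := le_infDist_intLattice_of_norm_eq_one hα hx.1 hx'.le
      have h2 := hx.2.trans (min_le_right _ _)
      rw [hnorm x hx.1] at h2
      linarith [hx.1]
    linarith

/-- Small ball estimate in terms of the essential least common denominator. -/
lemma measureReal_abs_sum_le_of_LCD {Ω : Type*} [MeasurableSpace Ω] {P : Measure Ω}
    [IsProbabilityMeasure P] {n : ℕ} {X : Fin n → Ω → ℝ} (hX : ∀ i, Measurable (X i))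
    (hind : iIndepFun X P) (μ : Measure ℝ) [IsProbabilityMeasure μ] (hμ : ∀ i, P.map (X i) = μ)
    {r p : ℝ} (hr : 0 < r) (hp : p < 1) (hlevy : ∀ a, μ.real {x | a ≤ x ∧ x ≤ a + r} ≤ p)
    {α : EuclideanSpace ℝ (Fin n)} (hα : ‖α‖ = 1) {γ ε : ℝ} (hγ : 0 < γ) (hε : 0 ≤ ε) :
    P.real {ω | |∑ i, α i * X i ω| ≤ ε} ≤
      2 * (2 * Real.exp (-(1 - p) * γ ^ 2) +
        (4 * (1 / LCD γ α) + 4 * Real.pi * ε / r) * √(Real.pi / ((1 - p) / 100))) := by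
  set K := √(Real.pi / ((1 - p) / 100))
  -- Enlarging the radius to `ε + δ` allows `ε = 0`, since Esseen's inequality needs a positive
  -- radius.
  refine le_of_forall_pos_le_add_mul (c := 8 * Real.pi / r * K + 8 * K) fun δ hδ => ?_
  have hmono : P.real {ω | |∑ i, α i * X i ω| ≤ ε} ≤ P.real {ω | |∑ i, α i * X i ω| ≤ ε + δ} :=
    measureReal_mono fun ω hω => le_trans (b := ε) hω (by linarith)
  refine hmono.trans ?_
  have hK : 0 ≤ K := Real.sqrt_nonneg _
  have key : ∀ D, 0 < D → (∀ θ, 0 < θ → θ < D → θ < LCD γ α ∨ LCD γ α ≤ 0) →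
      4 / D ≤ 4 * (1 / LCD γ α) + 4 * δ → P.real {ω | |∑ i, α i * X i ω| ≤ ε + δ} ≤
      2 * (2 * Real.exp (-(1 - p) * γ ^ 2) +
        (4 * (1 / LCD γ α) + 4 * Real.pi * ε / r) * K) +
        (8 * Real.pi / r * K + 8 * K) * δ := by
    intro D hD hDθ hle
    have h := measureReal_abs_sum_le_of_infDist hX hind μ hμ hr hp hlevy α hγ hD
      (by linarith : 0 < ε + δ)
      fun θ hθ hθD => min_le_infDist_of_lt_LCD hα hθ (hDθ θ hθ hθD)
    calc _ ≤ _ := h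
      _ ≤ 2 * (2 * Real.exp (-(1 - p) * γ ^ 2) +
        (4 * (1 / LCD γ α) + 4 * δ + 4 * Real.pi * (ε + δ) / r) * K) := by gcongr
      _ = _ := by ring
  rcases lt_or_ge 0 (LCD γ α) with hL | hL
  · refine key (LCD γ α) hL (fun θ _ hθ => Or.inl hθ) ?_
    rw [mul_one_div]
    linarith
  · have h0 : LCD γ α = 0 := le_antisymm hL (Real.sInf_nonneg fun x hx => hx.1.le)
    -- Here every `D` is admissible; this one gives `4/D = 4δ`, which vanishes in the limit.
    refine key (1 / δ) (by positivity) (fun _ _ _ => Or.inr hL) ?_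
    rw [h0]
    simp

/-! ### Exponential tails of linear forms. -/

section Chernoff

variable {Ω : Type*} [MeasurableSpace Ω] {P : Measure Ω} [IsProbabilityMeasure P] {n : ℕ}
  {X : Fin n → Ω → ℝ} {ν b : ℝ}

lemma measureReal_le_sum_le_exp (hb : 0 < b) (hX : ∀ i, Measurable (X i)) (hind : iIndepFun X P)
    (hsub : ∀ i, IsSubExponential (X i) ν b P) {β : EuclideanSpace ℝ (Fin n)} (hβ : 0 < ‖β‖)
    (t : ℝ) :
    P.real {ω | t ≤ ∑ i, β i * X i ω} ≤
      Real.exp (-(t / (b * ‖β‖))) * Real.exp (ν ^ 2 / (2 * b ^ 2)) := by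
  -- As `|βᵢ| ≤ ‖β‖`, every `l βᵢ` stays in the admissible range `[-1/b, 1/b]`, and the exponents
  -- add up to the constant `ν²/(2b²)`.
  set l := 1 / (b * ‖β‖) with hl
  have hlpos : 0 < l := by positivity
  have hlβ : ∀ i, |l * β i| ≤ 1 / b := fun i => by
    have h : |β i| ≤ ‖β‖ := PiLp.norm_apply_le β i
    rw [abs_mul, abs_of_pos hlpos]
    calc l * |β i| ≤ l * ‖β‖ := by gcongr
      _ = 1 / b := by rw [hl]; field_simp
  have hmY : ∀ i, Measurable fun ω => β i * X i ω := fun i => (hX i).const_mul _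
  have hindY : iIndepFun (fun i ω => β i * X i ω) P :=
    hind.comp (fun i x => β i * x) fun i => measurable_const_mul _
  have hint : Integrable (fun ω => Real.exp (l * (∑ i, fun ω => β i * X i ω) ω)) P := by
    refine hindY.integrable_exp_mul_sum hmY fun i _ => ?_
    simpa only [mul_assoc] using (hsub i).integrable_exp (l * β i) (hlβ i)
  have hmgf : mgf (∑ i, fun ω => β i * X i ω) P l ≤ Real.exp (ν ^ 2 / (2 * b ^ 2)) := by
    rw [hindY.mgf_sum hmY]
    calc _ ≤ ∏ i, Real.exp ((l * β i) ^ 2 * ν ^ 2 / 2) := by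
          refine Finset.prod_le_prod (fun _ _ => mgf_nonneg) fun i _ => ?_
          simpa only [mgf, mul_assoc] using (hsub i).mgf_le (l * β i) (hlβ i)
      _ = Real.exp (l ^ 2 * ν ^ 2 / 2 * ∑ i, β i ^ 2) := by
          rw [← Real.exp_sum, Finset.mul_sum]
          congr 1
          exact Finset.sum_congr rfl fun i _ => by ring
      _ = _ := by
          rw [← EuclideanSpace.real_norm_sq_eq, hl]
          congr 1
          field_simp
  have h := measure_ge_le_exp_mul_mgf t hlpos.le hint
  simp only [Finset.sum_apply] at h
  refine h.trans ?_
  have he : -l * t = -(t / (b * ‖β‖)) := by rw [hl]; ring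
  rw [he]
  gcongr

lemma measureReal_le_abs_sum_le_exp (hb : 0 < b) (hX : ∀ i, Measurable (X i))
    (hind : iIndepFun X P) (hsub : ∀ i, IsSubExponential (X i) ν b P)
    {β : EuclideanSpace ℝ (Fin n)} (hβ : 0 < ‖β‖) (t : ℝ) :
    P.real {ω | t ≤ |∑ i, β i * X i ω|} ≤
      2 * (Real.exp (-(t / (b * ‖β‖))) * Real.exp (ν ^ 2 / (2 * b ^ 2))) := by
  have h1 := measureReal_le_sum_le_exp hb hX hind hsub hβ t
  have h2 := measureReal_le_sum_le_exp hb hX hind hsub (β := -β) (by rwa [norm_neg]) t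
  rw [norm_neg] at h2
  simp only [PiLp.neg_apply, neg_mul, Finset.sum_neg_distrib] at h2
  calc P.real {ω | t ≤ |∑ i, β i * X i ω|}
      ≤ P.real ({ω | t ≤ ∑ i, β i * X i ω} ∪ {ω | t ≤ -∑ i, β i * X i ω}) :=
        measureReal_mono fun ω (hω : t ≤ |∑ i, β i * X i ω|) => le_abs.1 hω
    _ ≤ P.real {ω | t ≤ ∑ i, β i * X i ω} + P.real {ω | t ≤ -∑ i, β i * X i ω} :=
        measureReal_union_le _ _
    _ ≤ _ := by linarith

end Chernoff

end RelAntiConc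

/-! ### Combining the tail and small ball bounds. -/

theorem mainTheorem3 (ν b r p : ℝ) (hν : 0 < ν) (hb : 0 < b) (hr : 0 < r) (hp : p < 1) :
    ∃ c' : ℝ, 0 < c' ∧ ∀ κ : ℝ, 0 < κ → κ < 1 → ∃ C' : ℝ, 0 < C' ∧
      ∀ (Ω : Type*) [MeasurableSpace Ω] (P : Measure Ω) [IsProbabilityMeasure P]
        (n : ℕ) (X : Fin n → Ω → ℝ),
        (∀ i, Measurable (X i)) →
        iIndepFun X P →
        (∀ i j, IdentDistrib (X i) (X j) P P) →
        (∀ i, RelAntiConc.IsSubExponential (X i) ν b P) →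
        (∀ i, RelAntiConc.levyConcentration (X i) P r ≤ p) →
        ∀ (α β : EuclideanSpace ℝ (Fin n)) (γ : ℝ),
          α ≠ 0 → ‖β‖ ≤ κ * ‖α‖ → 0 < γ →
          P.real {ω | |∑ i, α i * X i ω| ≤ |∑ i, β i * X i ω|} ≤
            C' * (‖β‖ / ‖α‖ * Real.log (‖α‖ / ‖β‖)
              + 1 / RelAntiConc.LCD γ (‖α‖⁻¹ • α)
              + Real.exp (-c' * γ ^ 2)) := by
  have hpi := Real.pi_pos
  have hq : 0 < 1 - p := by linarith
  refine ⟨1 - p, hq, fun κ hκ0 hκ1 => ?_⟩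
  set K := √(Real.pi / ((1 - p) / 100)) with hK
  have hKpos : 0 < K := Real.sqrt_pos.2 (by positivity)
  set E := Real.exp (ν ^ 2 / (2 * b ^ 2)) with hE
  have hEpos : 0 < E := Real.exp_pos _
  have hℓ : 0 < Real.log (1 / κ) := Real.log_pos ((one_lt_div hκ0).2 hκ1)
  -- The first term comes from the small ball radius `b * R`, the second from bounding the tail
  -- `2Eρ` by a multiple of `R`.
  set C₁ := 8 * Real.pi * b / r * K + 2 * E / Real.log (1 / κ) with hC₁
  have hC₁pos : 0 < C₁ := by positivity
  refine ⟨4 + 8 * K + C₁, by positivity, ?_⟩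
  intro Ω _ P _ n X hX hind hid hsub hlevy α β γ hα hβ hγ
  have hαpos : 0 < ‖α‖ := norm_pos_iff.2 hα
  obtain ⟨i₀⟩ : Nonempty (Fin n) := by
    by_contra h
    rw [not_nonempty_iff] at h
    exact hα (Subsingleton.elim _ _)
  set α' := ‖α‖⁻¹ • α with hα'
  have hα'1 : ‖α'‖ = 1 := by
    rw [hα', norm_smul, norm_inv, norm_norm, inv_mul_cancel₀ hαpos.ne']
  have hprob : IsProbabilityMeasure (P.map (X i₀)) :=
    Measure.isProbabilityMeasure_map (hX i₀).aemeasurable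
  have hlevy' : ∀ a, (P.map (X i₀)).real {x | a ≤ x ∧ x ≤ a + r} ≤ p := fun a => by
    have hm : MeasurableSet {x : ℝ | a ≤ x ∧ x ≤ a + r} := measurableSet_Icc
    rw [map_measureReal_apply (hX i₀) hm]
    refine le_trans ?_ (hlevy i₀)
    exact le_ciSup (f := fun a : ℝ => P.real {ω | a ≤ X i₀ ω ∧ X i₀ ω ≤ a + r})
      ⟨1, by rintro _ ⟨a, rfl⟩; exact measureReal_le_one⟩ a
  have hsmall : ∀ ε, 0 ≤ ε → P.real {ω | |∑ i, α' i * X i ω| ≤ ε} ≤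
      2 * (2 * Real.exp (-(1 - p) * γ ^ 2) +
        (4 * (1 / RelAntiConc.LCD γ α') + 4 * Real.pi * ε / r) * K) := fun ε hε =>
    RelAntiConc.measureReal_abs_sum_le_of_LCD hX hind (P.map (X i₀)) (fun i => (hid i i₀).map_eq)
      hr hp hlevy' hα'1 hγ hε
  have hsum : ∀ ω, |∑ i, α' i * X i ω| = |∑ i, α i * X i ω| / ‖α‖ := fun ω => by
    have : ∑ i, α' i * X i ω = ‖α‖⁻¹ * ∑ i, α i * X i ω := by
      rw [Finset.mul_sum]
      exact Finset.sum_congr rfl fun i _ => by simp only [hα', PiLp.smul_apply, smul_eq_mul]; ring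
    rw [this, abs_mul, abs_of_pos (inv_pos.2 hαpos), div_eq_inv_mul]
  have hL : 0 ≤ 1 / RelAntiConc.LCD γ α' :=
    one_div_nonneg.2 (Real.sInf_nonneg fun x hx => hx.1.le)
  set Λ := 1 / RelAntiConc.LCD γ α'
  set G := Real.exp (-(1 - p) * γ ^ 2)
  have hG : 0 < G := Real.exp_pos _
  set R := ‖β‖ / ‖α‖ * Real.log (‖α‖ / ‖β‖) with hR
  suffices h : 0 ≤ R ∧ P.real {ω | |∑ i, α i * X i ω| ≤ |∑ i, β i * X i ω|} ≤
      4 * G + 8 * K * Λ + C₁ * R by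
    refine h.2.trans ?_
    have h1 : 0 ≤ (8 * K + C₁) * G := by positivity
    have h2 : 0 ≤ (4 + C₁) * Λ := by positivity
    have h3 : 0 ≤ (4 + 8 * K) * R := mul_nonneg (by positivity) h.1
    linarith
  rcases eq_or_ne β 0 with rfl | hβ0
  · refine ⟨by simp [hR], ?_⟩
    have hsub0 : P.real {ω | |∑ i, α i * X i ω| ≤ |∑ i, (0 : EuclideanSpace ℝ (Fin n)) i * X i ω|}
        ≤ P.real {ω | |∑ i, α' i * X i ω| ≤ 0} := by
      refine measureReal_mono fun ω hω => ?_
      have hω' : |∑ i, α i * X i ω| ≤ 0 := by simpa using hω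
      change |∑ i, α' i * X i ω| ≤ 0
      rw [hsum]
      exact div_nonpos_of_nonpos_of_nonneg hω' hαpos.le
    refine (hsub0.trans (hsmall 0 le_rfl)).trans_eq ?_
    simp only [hR, norm_zero, zero_div, zero_mul, mul_zero, add_zero]
    ring
  · have hβpos : 0 < ‖β‖ := norm_pos_iff.2 hβ0
    set L := Real.log (‖α‖ / ‖β‖) with hLdef
    have hLκ : Real.log (1 / κ) ≤ L := by
      refine Real.log_le_log (by positivity) ?_
      rw [div_le_div_iff₀ hκ0 hβpos]
      linarith
    have hLpos : 0 < L := hℓ.trans_le hLκ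
    have hρpos : 0 < ‖β‖ / ‖α‖ := by positivity
    have hRpos : 0 < R := mul_pos hρpos hLpos
    refine ⟨hRpos.le, ?_⟩
    -- The threshold `b‖β‖L` is chosen so that the Chernoff exponential is exactly `‖β‖/‖α‖`.
    have hexp : Real.exp (-(b * ‖β‖ * L / (b * ‖β‖))) = ‖β‖ / ‖α‖ := by
      rw [mul_div_cancel_left₀ L (by positivity : b * ‖β‖ ≠ 0), Real.exp_neg, hLdef,
        Real.exp_log (by positivity), inv_div]
    have htail := RelAntiConc.measureReal_le_abs_sum_le_exp hb hX hind hsub hβpos (b * ‖β‖ * L)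
    rw [hexp, ← hE] at htail
    have hρR : 2 * (‖β‖ / ‖α‖ * E) ≤ 2 * E / Real.log (1 / κ) * R := by
      rw [div_mul_eq_mul_div (2 * E), le_div_iff₀ hℓ, hR]
      have := mul_le_mul_of_nonneg_left hLκ (by positivity : 0 ≤ 2 * (‖β‖ / ‖α‖ * E))
      linarith
    have hball := hsmall (b * R) (by positivity)
    have hunion : P.real {ω | |∑ i, α i * X i ω| ≤ |∑ i, β i * X i ω|} ≤
        P.real {ω | |∑ i, α' i * X i ω| ≤ b * R} +
          P.real {ω | b * ‖β‖ * L ≤ |∑ i, β i * X i ω|} := by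
      refine (measureReal_mono fun ω hω => ?_).trans (measureReal_union_le _ _)
      have hω' : |∑ i, α i * X i ω| ≤ |∑ i, β i * X i ω| := hω
      rcases le_total (b * ‖β‖ * L) |∑ i, β i * X i ω| with h | h
      · exact Or.inr h
      · refine Or.inl ?_
        change |∑ i, α' i * X i ω| ≤ b * R
        rw [hsum, div_le_iff₀ hαpos, hR]
        have : b * (‖β‖ / ‖α‖ * L) * ‖α‖ = b * ‖β‖ * L := by field_simp
        linarith
    calc _ ≤ _ := hunion
      _ ≤ 2 * (2 * G + (4 * Λ + 4 * Real.pi * (b * R) / r) * K) +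
          2 * E / Real.log (1 / κ) * R := by linarith
      _ = _ := by rw [hC₁]; ring
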